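/- **Theorem 1.2.** Let $r \ge 0$, and let $B$ be a finite set of $n \ge 1$ vectors in $\mathbb Z^r$. Let $\beta$ be the maximum of the absolute values of the entries of the elements of $B$ (with $\beta = 0$ if $r = 0$). For $b \in \mathbb Z^r$ write $x^{b^+} = \prod_{i=1}^r x_i^{\max(b_i,0)}$ and $x^{b^-} = \prod_{i=1}^r x_i^{\max(-b_i,0)}$, and let $I_B$ be the ideal of $R = \mathbb Z[x_1,\dots,x_r]$ generated by the binomials $x^{b^+} - x^{b^-}$ with $b \in B$. Let $$\mathrm{Sat}(I_B) = \{a \in R : a\,(x_1\cdots x_r)^m \in I_B \text{ for some integer } m > 0\}$$ be the saturation of $I_B$ with respect to $x_1 \cdots x_r$. The *norm* of $B$ is the smallest integer $N \ge 1$ for which there is a finite set $G \subseteq R$ generating the ideal $\mathrm{Sat}(I_B)$ such that every $g \in G$ is a difference of two monomials (with coefficient $1$) of $R$ and can be written, in the Laurent polynomial ring $\mathbb Z[x_1^{\pm1},\dots,x_r^{\pm1}]$, as $$g = \sum_{i=1}^N \epsilon_i\, m_i\,(x^{b_i^+} - x^{b_i^-}),$$ where $\epsilon_i \in \{-1,0,1\}$,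 the $m_i$ are Laurent monomials $x_1^{d_1}\cdots x_r^{d_r}$ with $d_1,\dots,d_r \in \mathbb Z$, and the $b_i$ are (not necessarily distinct) elements of $B$. Then such an $N$ exists, and the norm of $B$ is at most $$n(2n\beta)^{n-1},$$ where $0^0 = 1$. -/

import Mathlib

namespace BinomialNorm

open MvPolynomial

/-- The monomial `x^{b⁺}` of an integer vector `b`, with exponents `max (b i) 0`. -/
noncomputable def posMonomial {r : ℕ} (b : Fin r → ℤ) : MvPolynomial (Fin r) ℤ :=
  ∏ i, X i ^ (b i).toNat

/-- The monomial `x^{b⁻}` of an integer vector `b`, with exponents `max (-b i) 0`. -/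
noncomputable def negMonomial {r : ℕ} (b : Fin r → ℤ) : MvPolynomial (Fin r) ℤ :=
  ∏ i, X i ^ (-b i).toNat

/-- The binomial `x^{b⁺} - x^{b⁻}`. -/
noncomputable def vecBinomial {r : ℕ} (b : Fin r → ℤ) : MvPolynomial (Fin r) ℤ :=
  posMonomial b - negMonomial b

/-- The ideal `I_B = (x^{b⁺} - x^{b⁻} : b ∈ B)` of `ℤ[x₁, …, x_r]`. -/
noncomputable def vecIdeal {r : ℕ} (B : Finset (Fin r → ℤ)) : Ideal (MvPolynomial (Fin r) ℤ) :=
  Ideal.span (vecBinomial '' (B : Set (Fin r → ℤ)))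

/-- The saturation `{a | ∃ m > 0, a * f ^ m ∈ I}` of an ideal `I` with respect to `f`. -/
def saturation {R : Type*} [CommRing R] (I : Ideal R) (f : R) : Ideal R where
  carrier := {a | ∃ m : ℕ, 0 < m ∧ a * f ^ m ∈ I}
  zero_mem' := ⟨1, one_pos, by simp⟩
  add_mem' := by
    rintro a b ⟨m, hm, ha⟩ ⟨k, -, hb⟩
    refine ⟨m + k, by omega, ?_⟩
    have h : (a + b) * f ^ (m + k) = f ^ k * (a * f ^ m) + f ^ m * (b * f ^ k) := by ring
    rw [h]
    exact I.add_mem (I.mul_mem_left _ ha) (I.mul_mem_left _ hb)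
  smul_mem' := by
    rintro c a ⟨m, hm, ha⟩
    refine ⟨m, hm, ?_⟩
    rw [smul_eq_mul, mul_assoc]
    exact I.mul_mem_left _ ha

/-- A pure (difference) binomial: a difference of two monomials with coefficient one. -/
def IsPureBinomial {r : ℕ} (g : MvPolynomial (Fin r) ℤ) : Prop :=
  ∃ s t : Fin r →₀ ℕ, g = monomial s 1 - monomial t 1

/-- The Laurent polynomial ring `ℤ[x₁^{±1}, …, x_r^{±1}]`, as the group ring of `ℤ^r`. -/
abbrev LaurentRing (r : ℕ) : Type := AddMonoidAlgebra ℤ (Fin r → ℤ)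

/-- The Laurent monomial `x^d`, `d ∈ ℤ^r`. -/
noncomputable def laurentMonomial {r : ℕ} (d : Fin r → ℤ) : LaurentRing r :=
  AddMonoidAlgebra.single d 1

/-- The inclusion `ℤ[x₁, …, x_r] → ℤ[x₁^{±1}, …, x_r^{±1}]`. -/
noncomputable def toLaurent (r : ℕ) : MvPolynomial (Fin r) ℤ →ₐ[ℤ] LaurentRing r :=
  aeval fun i => laurentMonomial (Pi.single i 1)

/-- `g = ∑_{i=1}^N ε_i m_i (x^{b_i⁺} - x^{b_i⁻})` with `ε_i ∈ {-1, 0, 1}`, `b_i ∈ B`, and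
Laurent monomials `m_i`. (With monomials of the polynomial ring every such `g` would lie in `I_B`,
so that nothing outside `I_B` could be written in this way.) -/
def IsSignedSum {r : ℕ} (B : Finset (Fin r → ℤ)) (N : ℕ) (g : MvPolynomial (Fin r) ℤ) : Prop :=
  ∃ (ε : Fin N → ℤ) (d : Fin N → Fin r → ℤ) (b : Fin N → Fin r → ℤ),
    (∀ i, ε i = -1 ∨ ε i = 0 ∨ ε i = 1) ∧ (∀ i, b i ∈ B) ∧
    toLaurent r g = ∑ i, ε i • (laurentMonomial (d i) * toLaurent r (vecBinomial (b i)))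

/-- The integers `N ≥ 1` such that the saturation of `I_B` with respect to `x₁ ⋯ x_r` has a finite
generating set of pure binomials, each a signed sum of `N` terms. The norm of `B` is the least
such integer. -/
def normSet {r : ℕ} (B : Finset (Fin r → ℤ)) : Set ℕ :=
  {N | 1 ≤ N ∧ ∃ G : Finset (MvPolynomial (Fin r) ℤ),
    Ideal.span (G : Set (MvPolynomial (Fin r) ℤ)) = saturation (vecIdeal B) (∏ i, X i) ∧
    (∀ g ∈ G, IsPureBinomial g) ∧ ∀ g ∈ G, IsSignedSum B N g}

/-- The norm of `B`, the least element of `normSet B` (with value `0` if there were none). -/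
noncomputable def norm {r : ℕ} (B : Finset (Fin r → ℤ)) : ℕ := sInf (normSet B)

/-- The largest absolute value of an entry of a vector in `B` (`0` if there are no entries). -/
def maxEntry {r : ℕ} (B : Finset (Fin r → ℤ)) : ℕ :=
  B.sup fun b => Finset.univ.sup fun i => (b i).natAbs

end BinomialNorm

/-! Let `A` have the n elements of `B` as columns. The saturation is the lattice ideal of the span
of `B`, generated by the binomials of the vectors `A c` with `c` integral. Telescoping along a
lattice path writes the binomial of `A c` with ‖c‖₁ terms, so it suffices that the `c` with ‖c‖₁ ≤ N
already give generators (`span_shortBinomials`).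

If `c = v + w`, and `A v` and `A w` have compatible signs, a difference of monomials with exponent
difference `A c` splits through an intermediate monomial into differences for `v` and `w`. So `c` is
to be decomposed inside the cone of vectors sharing the signs of `c` and of `A c`
(`conformal_induction`). This cone is pointed, and its facet normals have entries at most β' =
max(1, β). By Siegel's lemma every extreme ray contains a nonzero integral vector of ℓ¹-length at
most D = n(nβ')^(n-1). A descent through faces, as for Carathéodory's theorem, splits off a short
vector once ‖c‖₁ > nD (`le_or_exists_sub_mem_cone`). Finally n ≤ 2^(n-1) absorbs the extra factor n.
-/

/-! ### Faces and extreme rays of pointed rational cones. -/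

section PointedCone

variable {V ι : Type*} [AddCommGroup V] [Module ℚ V]

/-- The common kernel of the linear forms `φ i`, `i ∈ Z`. -/
def commonKer (φ : ι → V →ₗ[ℚ] ℚ) (Z : Finset ι) : Submodule ℚ V :=
  ⨅ i ∈ Z, LinearMap.ker (φ i)

theorem mem_commonKer {φ : ι → V →ₗ[ℚ] ℚ} {Z : Finset ι} {x : V} :
    x ∈ commonKer φ Z ↔ ∀ i ∈ Z, φ i x = 0 := by
  simp [commonKer]

theorem finrank_commonKer_insert_lt [FiniteDimensional ℚ V] [DecidableEq ι]
    {φ : ι → V →ₗ[ℚ] ℚ} {Z : Finset ι} {w : V} {i : ι}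
    (hw : w ∈ commonKer φ Z) (hi : φ i w ≠ 0) :
    Module.finrank ℚ (commonKer φ (insert i Z)) < Module.finrank ℚ (commonKer φ Z) := by
  apply Submodule.finrank_lt_finrank_of_lt
  refine lt_of_le_of_ne (fun x hx => ?_) fun h => ?_
  · rw [mem_commonKer] at hx ⊢
    exact fun j hj => hx j (Finset.mem_insert_of_mem hj)
  · rw [← h, mem_commonKer] at hw
    exact hi (hw i (Finset.mem_insert_self i Z))

/-- Moving from a point of a cone in a direction that leaves the cone, one meets a facet. -/
theorem exists_add_smul_mem_facet [Finite ι] {φ : ι → V →ₗ[ℚ] ℚ} {x w : V}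
    (hx : ∀ i, 0 ≤ φ i x) (hw : ∃ i, φ i w < 0) :
    ∃ t : ℚ, 0 ≤ t ∧ (∀ i, 0 ≤ φ i (x + t • w)) ∧ ∃ i, φ i w < 0 ∧ φ i (x + t • w) = 0 := by
  obtain ⟨i₀, hi₀⟩ := hw
  -- The least ratio belongs to the first facet that the ray from `x` hits.
  obtain ⟨i, hi, hmin⟩ := Set.exists_min_image {i | φ i w < 0} (fun i => φ i x / -φ i w)
    (Set.toFinite _) ⟨i₀, hi₀⟩
  have hi' : 0 < -φ i w := neg_pos.2 hi
  refine ⟨φ i x / -φ i w, div_nonneg (hx i) hi'.le, fun j => ?_, i, hi, ?_⟩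
  · rw [map_add, map_smul, smul_eq_mul]
    rcases lt_or_ge (φ j w) 0 with hj | hj
    · have h := hmin j hj
      rw [le_div_iff₀ (neg_pos.2 hj)] at h
      linarith
    · exact add_nonneg (hx j) (mul_nonneg (div_nonneg (hx i) hi'.le) hj)
  · have : φ i w ≠ 0 := ne_of_lt hi
    rw [map_add, map_smul, smul_eq_mul]
    field_simp
    ring

variable [FiniteDimensional ℚ V] [Finite ι] {φ : ι → V →ₗ[ℚ] ℚ}

/-- In a pointed cone all of whose extreme rays meet `S`, every nonzero face meets `S`. -/
theorem exists_mem_face_of_rays (hφ : ∀ x, (∀ i, φ i x = 0) → x = 0) {S : Set V}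
    (hS : ∀ (Z : Finset ι) (x : V), x ≠ 0 → (∀ i, 0 ≤ φ i x) → commonKer φ Z = ℚ ∙ x →
      Z.card < Module.finrank ℚ V → ∃ p ∈ S, p ≠ 0 ∧ (∀ i, 0 ≤ φ i p) ∧ p ∈ commonKer φ Z)
    (Z : Finset ι) (x : V) (hx0 : x ≠ 0) (hx : ∀ i, 0 ≤ φ i x) (hxZ : x ∈ commonKer φ Z)
    (hZ : Z.card + Module.finrank ℚ (commonKer φ Z) ≤ Module.finrank ℚ V) :
    ∃ p ∈ S, p ≠ 0 ∧ (∀ i, 0 ≤ φ i p) ∧ p ∈ commonKer φ Z := by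
  classical
  induction hd : Module.finrank ℚ (commonKer φ Z) using Nat.strong_induction_on
    generalizing Z x with
  | _ d ih =>
    by_cases hspan : commonKer φ Z ≤ ℚ ∙ x
    · have hle : (ℚ ∙ x) ≤ commonKer φ Z := by
        rwa [Submodule.span_singleton_le_iff_mem]
      have heq := le_antisymm hspan hle
      refine hS Z x hx0 hx heq ?_
      -- On a line, the invariant `hZ` leaves fewer than dim V equations, as Siegel's lemma
      -- requires.
      rw [heq, finrank_span_singleton hx0] at hZ
      omega
    · obtain ⟨w, hwZ, hwx⟩ := SetLike.not_le_iff_exists.1 hspan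
      have key : ∀ w ∈ commonKer φ Z, w ∉ ℚ ∙ x → (∃ i, φ i w < 0) →
          ∃ p ∈ S, p ≠ 0 ∧ (∀ i, 0 ≤ φ i p) ∧ p ∈ commonKer φ Z := by
        intro w hwZ hwx hneg
        obtain ⟨t, -, hC, i, hiw, hi⟩ := exists_add_smul_mem_facet hx hneg
        have hlt := finrank_commonKer_insert_lt hwZ hiw.ne
        have hcard := Finset.card_insert_le i Z
        have hne : x + t • w ≠ 0 := by
          intro h0
          by_cases ht : t = 0
          · simp [ht] at h0
            exact hx0 h0
          · apply hwx
            rw [Submodule.mem_span_singleton]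
            refine ⟨-t⁻¹, ?_⟩
            have : x = -(t • w) := eq_neg_of_add_eq_zero_left h0
            rw [this, neg_smul, smul_neg, neg_neg, smul_smul, inv_mul_cancel₀ ht, one_smul]
        have hmem : x + t • w ∈ commonKer φ (insert i Z) := by
          rw [mem_commonKer]
          intro j hj
          rcases Finset.mem_insert.1 hj with rfl | hj
          · exact hi
          · rw [map_add, map_smul, mem_commonKer.1 hxZ j hj, mem_commonKer.1 hwZ j hj]
            simp
        obtain ⟨p, hpS, hp0, hp, hpZ⟩ := ih _ (hd ▸ hlt) (insert i Z) (x + t • w) hne hC hmem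
          (by omega) rfl
        refine ⟨p, hpS, hp0, hp, ?_⟩
        rw [mem_commonKer] at hpZ ⊢
        exact fun j hj => hpZ j (Finset.mem_insert_of_mem hj)
      by_cases hneg : ∃ i, φ i w < 0
      · exact key w hwZ hwx hneg
      -- By pointedness some form is nonzero on `w`, hence negative on `-w`.
      · refine key (-w) (neg_mem hwZ) (fun h => hwx (by simpa using neg_mem h)) ?_
        push Not at hneg
        have hw0 : w ≠ 0 := fun h => hwx (h ▸ zero_mem _)
        have : ∃ i, φ i w ≠ 0 := by
          by_contra! h
          exact hw0 (hφ w h)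
        obtain ⟨i, hi⟩ := this
        exact ⟨i, by rw [map_neg]; exact neg_neg_of_pos (lt_of_le_of_ne (hneg i) hi.symm)⟩

/-- A point of a pointed cone that is long with respect to `ℓ` has a summand in `S`. -/
theorem le_or_exists_sub_mem_cone (hφ : ∀ x, (∀ i, φ i x = 0) → x = 0) {S : Set V}
    (hS : ∀ (Z : Finset ι) (x : V), x ≠ 0 → (∀ i, 0 ≤ φ i x) → commonKer φ Z = ℚ ∙ x →
      Z.card < Module.finrank ℚ V → ∃ p ∈ S, p ≠ 0 ∧ (∀ i, 0 ≤ φ i p) ∧ p ∈ commonKer φ Z)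
    (ℓ : V →ₗ[ℚ] ℚ) {D : ℚ} (hD0 : 0 ≤ D) (hD : ∀ p ∈ S, ℓ p ≤ D)
    (Z : Finset ι) (x : V) (hx : ∀ i, 0 ≤ φ i x) (hxZ : x ∈ commonKer φ Z)
    (hZ : Z.card + Module.finrank ℚ (commonKer φ Z) ≤ Module.finrank ℚ V) :
    ℓ x ≤ Module.finrank ℚ (commonKer φ Z) * D ∨
      ∃ p ∈ S, p ≠ 0 ∧ (∀ i, 0 ≤ φ i p) ∧ ∀ i, 0 ≤ φ i (x - p) := by
  classical
  induction hd : Module.finrank ℚ (commonKer φ Z) using Nat.strong_induction_on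
    generalizing Z x with
  | _ d ih =>
    by_cases hx0 : x = 0
    · left
      rw [hx0, map_zero]
      positivity
    obtain ⟨p, hpS, hp0, hp, hpZ⟩ := exists_mem_face_of_rays hφ hS Z x hx0 hx hxZ hZ
    have hneg : ∃ i, φ i (-p) < 0 := by
      by_contra! h
      refine hp0 (hφ p fun i => le_antisymm ?_ (hp i))
      simpa using h i
    -- Subtract `p` until a facet is met. If this takes `t ≥ 1`, then `p` is a summand; otherwise
    -- `ℓ` has dropped by at most `D` and the dimension of the common kernel by at least one.
    obtain ⟨t, ht0, hC, i, hip, hi⟩ := exists_add_smul_mem_facet hx hneg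
    rcases le_or_gt 1 t with ht | ht
    · refine Or.inr ⟨p, hpS, hp0, hp, fun j => ?_⟩
      have h1 := hC j
      have h2 := mul_nonneg (sub_nonneg.2 ht) (hp j)
      simp only [map_add, map_sub, map_smul, map_neg, smul_eq_mul] at h1 ⊢
      linarith
    · have hlt := finrank_commonKer_insert_lt (neg_mem hpZ) hip.ne
      have hcard := Finset.card_insert_le i Z
      have hZ' : x + t • -p ∈ commonKer φ (insert i Z) := by
        rw [mem_commonKer]
        intro j hj
        rcases Finset.mem_insert.1 hj with rfl | hj
        · exact hi
        · rw [map_add, map_smul, map_neg, mem_commonKer.1 hxZ j hj, mem_commonKer.1 hpZ j hj]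
          simp
      rcases ih _ (hd ▸ hlt) (insert i Z) _ hC hZ' (by omega) rfl with h | ⟨q, hqS, hq0, hq, hxq⟩
      · left
        have h1 : ℓ x = ℓ (x + t • -p) + t * ℓ p := by simp
        have h2 : t * ℓ p ≤ D := by nlinarith [hD p hpS, mul_le_mul_of_nonneg_left (hD p hpS) ht0]
        have h3 : ((Module.finrank ℚ (commonKer φ (insert i Z)) : ℕ) : ℚ) + 1 ≤ d := by
          exact_mod_cast hd ▸ hlt
        have h4 := mul_le_mul_of_nonneg_right h3 hD0
        linarith
      · refine Or.inr ⟨q, hqS, hq0, hq, fun j => ?_⟩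
        have h1 := hxq j
        have h2 := mul_nonneg ht0 (hp j)
        simp only [map_add, map_sub, map_smul, map_neg, smul_eq_mul] at h1 ⊢
        linarith

end PointedCone

/-! ### Short integral solutions of linear systems. -/

section Siegel

attribute [local instance] Matrix.seminormedAddCommGroup

/-- Siegel's lemma with an exponent that only depends on the number of unknowns. -/
theorem exists_ne_zero_int_vec_abs_le {α κ : Type*} [Fintype α] [Fintype κ] (A : Matrix α κ ℤ)
    (h : Fintype.card α < Fintype.card κ) {β : ℕ} (hβ : 1 ≤ β) (hA : ∀ i j, |A i j| ≤ β) :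
    ∃ t : κ → ℤ, t ≠ 0 ∧ A.mulVec t = 0 ∧
      ∀ j, |t j| ≤ ((Fintype.card κ * β) ^ (Fintype.card κ - 1) : ℕ) := by
  have hκ : 1 ≤ Fintype.card κ := by omega
  have hb : 1 ≤ Fintype.card κ * β := Nat.mul_pos hκ hβ
  -- The empty system is treated apart, by the all-ones vector.
  rcases Nat.eq_zero_or_pos (Fintype.card α) with h0 | h0
  · have := Fintype.card_eq_zero_iff.1 h0
    obtain ⟨j⟩ := Fintype.card_pos_iff.1 hκ
    refine ⟨1, fun h => one_ne_zero (congrFun h j), Subsingleton.elim _ _, fun j => ?_⟩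
    simpa using mod_cast Nat.one_le_pow _ _ hb
  · obtain ⟨t, ht0, ht, hle⟩ := Int.Matrix.exists_ne_zero_int_vec_norm_le A h h0
    refine ⟨t, ht0, ht, fun j => ?_⟩
    have hn : ‖A‖ ≤ β := by
      rw [Matrix.norm_le_iff (Nat.cast_nonneg β)]
      intro i j
      rw [Int.norm_eq_abs]
      exact_mod_cast hA i j
    have h1 : (1 : ℝ) ≤ Fintype.card κ - Fintype.card α := by
      rw [le_sub_iff_add_le]
      exact_mod_cast (by omega : 1 + Fintype.card α ≤ Fintype.card κ)
    have hmax : max 1 ‖A‖ ≤ β := max_le (mod_cast hβ) hn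
    have h2 : ‖t j‖ ≤ ((Fintype.card κ * β : ℕ) : ℝ) ^ ((Fintype.card κ - 1 : ℕ) : ℝ) := by
      refine (norm_le_pi_norm t j).trans (hle.trans ?_)
      calc _ ≤ ((Fintype.card κ * β : ℕ) : ℝ) ^
            ((Fintype.card α : ℝ) / (Fintype.card κ - Fintype.card α)) := by
            push_cast
            gcongr
        _ ≤ _ := by
            refine Real.rpow_le_rpow_of_exponent_le (mod_cast hb) ?_
            -- With m equations in n unknowns, m/(n-m) ≤ m ≤ n-1.
            refine (div_le_self (Nat.cast_nonneg _) h1).trans ?_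
            exact_mod_cast (by omega : Fintype.card α ≤ Fintype.card κ - 1)
    rw [Real.rpow_natCast, Int.norm_eq_abs] at h2
    exact_mod_cast h2

end Siegel

/-! ### Sign-compatible decomposition of integral vectors. -/

section Conformal

variable {ι κ ρ : Type*} [Fintype κ]

/-- The rational linear form with integer coefficients `a`. -/
def intForm (a : κ → ℤ) : (κ → ℚ) →ₗ[ℚ] ℚ :=
  ∑ j, (a j : ℚ) • LinearMap.proj j

theorem intForm_apply (a : κ → ℤ) (x : κ → ℚ) : intForm a x = ∑ j, (a j : ℚ) * x j := by
  simp [intForm]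

theorem intForm_intCast (a v : κ → ℤ) :
    intForm a (fun j => (v j : ℚ)) = ((a ⬝ᵥ v : ℤ) : ℚ) := by
  simp [intForm_apply, dotProduct]

/-- An integral point of a pointed cone with integral facet normals is short, or has a short
integral summand. -/
theorem dotProduct_le_or_exists_sub_mem_cone [Finite ι] {M : Matrix ι κ ℤ} {β : ℕ} (hβ : 1 ≤ β)
    (hM : ∀ i j, |M i j| ≤ β) (hφ : ∀ x : κ → ℚ, (∀ i, intForm (M i) x = 0) → x = 0)
    {e : κ → ℤ} (he : ∀ j, |e j| ≤ 1) {c : κ → ℤ} (hc : ∀ i, 0 ≤ M i ⬝ᵥ c) :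
    e ⬝ᵥ c ≤ (Fintype.card κ * (Fintype.card κ *
        (Fintype.card κ * β) ^ (Fintype.card κ - 1)) : ℕ) ∨
      ∃ v : κ → ℤ, v ≠ 0 ∧ e ⬝ᵥ v ≤ (Fintype.card κ *
        (Fintype.card κ * β) ^ (Fintype.card κ - 1) : ℕ) ∧
        (∀ i, 0 ≤ M i ⬝ᵥ v) ∧ ∀ i, 0 ≤ M i ⬝ᵥ (c - v) := by
  classical
  set b : ℕ := (Fintype.card κ * β) ^ (Fintype.card κ - 1) with hb
  have hbound : ∀ v : κ → ℤ, (∀ j, |v j| ≤ b) → e ⬝ᵥ v ≤ (Fintype.card κ * b : ℕ) := by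
    intro v hv
    calc e ⬝ᵥ v ≤ ∑ _j : κ, (b : ℤ) := by
          refine Finset.sum_le_sum fun j _ => (le_abs_self _).trans ?_
          rw [abs_mul]
          exact (mul_le_of_le_one_left (abs_nonneg _) (he j)).trans (hv j)
      _ = _ := by simp
  let S : Set (κ → ℚ) := {p | ∃ v : κ → ℤ, (∀ j, |v j| ≤ b) ∧ p = fun j => (v j : ℚ)}
  have hS : ∀ (Z : Finset ι) (x : κ → ℚ), x ≠ 0 → (∀ i, 0 ≤ intForm (M i) x) →
      commonKer (fun i => intForm (M i)) Z = ℚ ∙ x → Z.card < Module.finrank ℚ (κ → ℚ) →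
      ∃ p ∈ S, p ≠ 0 ∧ (∀ i, 0 ≤ intForm (M i) p) ∧ p ∈ commonKer (fun i => intForm (M i)) Z := by
    intro Z x _ hx hZ hcard
    obtain ⟨t, ht0, ht, hle⟩ := exists_ne_zero_int_vec_abs_le
      (Matrix.of fun (i : Z) j => M i j) (by simpa using hcard) hβ (fun i j => hM i j)
    have htZ : (fun j => (t j : ℚ)) ∈ commonKer (fun i => intForm (M i)) Z := by
      rw [mem_commonKer]
      intro i hi
      rw [intForm_intCast]
      exact_mod_cast congrFun ht ⟨i, hi⟩
    have ht0' : (fun j => (t j : ℚ)) ≠ 0 := by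
      intro h
      exact ht0 (funext fun j => Int.cast_eq_zero.1 (congrFun h j))
    -- The solution lies on the line through `x`, so it or its negative lies in the cone.
    obtain ⟨a, ha⟩ := Submodule.mem_span_singleton.1 (hZ ▸ htZ)
    rcases le_total 0 a with h | h
    · refine ⟨_, ⟨t, hle, rfl⟩, ht0', fun i => ?_, htZ⟩
      rw [← ha, map_smul, smul_eq_mul]
      exact mul_nonneg h (hx i)
    · refine ⟨-fun j => (t j : ℚ), ⟨-t, fun j => by simpa only [Pi.neg_apply, abs_neg] using hle j, by ext; simp⟩,
        neg_ne_zero.2 ht0', fun i => ?_, neg_mem htZ⟩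
      rw [← ha, map_neg, map_smul, smul_eq_mul, ← neg_mul]
      exact mul_nonneg (neg_nonneg.2 h) (hx i)
  have hW : (∅ : Finset ι).card + Module.finrank ℚ (commonKer (fun i => intForm (M i)) ∅) ≤
      Module.finrank ℚ (κ → ℚ) := by
    simpa using Submodule.finrank_le (commonKer (fun i => intForm (M i)) ∅)
  have hD : ∀ p ∈ S, intForm e p ≤ ((Fintype.card κ * b : ℕ) : ℚ) := by
    rintro p ⟨v, hv, rfl⟩
    rw [intForm_intCast]
    exact_mod_cast hbound v hv
  have hc' : ∀ i, 0 ≤ intForm (M i) (fun j => (c j : ℚ)) := by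
    intro i
    rw [intForm_intCast]
    exact_mod_cast hc i
  rcases le_or_exists_sub_mem_cone hφ hS (intForm e) (Nat.cast_nonneg _) hD ∅
    (fun j => (c j : ℚ)) hc' (by simp [mem_commonKer]) hW with
    h | ⟨p, ⟨v, hv, rfl⟩, hp0, hp, hcp⟩
  · left
    rw [intForm_intCast] at h
    have h2 : ((Module.finrank ℚ (commonKer (fun i => intForm (M i)) ∅) : ℕ) : ℚ) ≤
        Fintype.card κ := by
      simpa using hW
    have h3 := h.trans (mul_le_mul_of_nonneg_right h2 (Nat.cast_nonneg _))
    exact_mod_cast h3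
  · refine Or.inr ⟨v, ?_, hbound v hv, fun i => ?_, fun i => ?_⟩
    · rintro rfl
      exact hp0 (by ext; simp)
    · have := hp i
      rw [intForm_intCast] at this
      exact_mod_cast this
    · have := hcp i
      rw [map_sub, intForm_intCast, intForm_intCast] at this
      rw [dotProduct_sub]
      exact_mod_cast this

/-- Every integral vector is a sum of short ones whose images under `A` have compatible signs. -/
theorem conformal_induction [Finite ρ] {A : Matrix ρ κ ℤ} {β : ℕ} (hβ : 1 ≤ β)
    (hA : ∀ i j, |A i j| ≤ β) {N : ℕ} (hN : Fintype.card κ * (Fintype.card κ *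
        (Fintype.card κ * β) ^ (Fintype.card κ - 1)) ≤ N)
    {P : (κ → ℤ) → Prop} (short : ∀ c, ∑ j, (c j).natAbs ≤ N → P c)
    (add : ∀ v w, (∀ i, (0 ≤ A.mulVec v i ∧ 0 ≤ A.mulVec w i) ∨
      (A.mulVec v i ≤ 0 ∧ A.mulVec w i ≤ 0)) → P v → P w → P (v + w)) (c : κ → ℤ) : P c := by
  classical
  induction hd : ∑ j, (c j).natAbs using Nat.strong_induction_on generalizing c with
  | _ d ih =>
  -- The value at 0 is 1, so no coordinate form vanishes identically.
  let sgn : ℤ → ℤ := fun a => if 0 ≤ a then 1 else -1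
  have sgn_abs : ∀ a, |sgn a| = 1 := fun a => by dsimp only [sgn]; split_ifs <;> simp
  have sgn_mul : ∀ a, sgn a * a = |a| := fun a => by
    dsimp only [sgn]
    split_ifs with h
    · rw [abs_of_nonneg h, one_mul]
    · rw [abs_of_neg (not_le.1 h), neg_one_mul]
  have sgn_cases : ∀ a x y, 0 ≤ sgn a * x → 0 ≤ sgn a * y →
      (0 ≤ x ∧ 0 ≤ y) ∨ (x ≤ 0 ∧ y ≤ 0) := fun a x y => by
    dsimp only [sgn]
    split_ifs <;> intros <;> omega
  have sgn_natAbs : ∀ a x, 0 ≤ sgn a * x → sgn a * x = x.natAbs := fun a x => by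
    dsimp only [sgn]
    split_ifs <;> intros <;> omega
  let e : κ → ℤ := fun j => sgn (c j)
  -- The rows from `A` impose sign compatibility; the coordinate rows make the cone pointed and the
  -- ℓ¹-norm equal to the linear form `e` on it.
  let M : Matrix (ρ ⊕ κ) κ ℤ := fun i => Sum.elim
    (fun i : ρ => sgn (A.mulVec c i) • A i) (fun j : κ => Pi.single j (sgn (c j))) i
  have hMl : ∀ i v, M (Sum.inl i) ⬝ᵥ v = sgn (A.mulVec c i) * A.mulVec v i := fun i v =>
    smul_dotProduct _ _ _
  have hMr : ∀ j v, M (Sum.inr j) ⬝ᵥ v = sgn (c j) * v j := fun j v =>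
    single_dotProduct _ _ _
  have hlen : ∀ v, (∀ i, 0 ≤ M i ⬝ᵥ v) → e ⬝ᵥ v = ((∑ j, (v j).natAbs : ℕ) : ℤ) := by
    intro v hv
    rw [Nat.cast_sum]
    refine Finset.sum_congr rfl fun j _ => sgn_natAbs (c j) (v j) ?_
    rw [← hMr]
    exact hv _
  have hc : ∀ i, 0 ≤ M i ⬝ᵥ c := by
    rintro (i | j)
    · rw [hMl, sgn_mul]
      exact abs_nonneg _
    · rw [hMr, sgn_mul]
      exact abs_nonneg _
  have hMβ : ∀ i k, |M i k| ≤ β := by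
    rintro (i | j) k
    · change |sgn (A.mulVec c i) * A i k| ≤ β
      rw [abs_mul, sgn_abs, one_mul]
      exact hA i k
    · change |(Pi.single j (sgn (c j)) : κ → ℤ) k| ≤ β
      rw [Pi.single_apply]
      split_ifs
      · rw [sgn_abs]
        exact_mod_cast hβ
      · simp
  have hφ : ∀ x : κ → ℚ, (∀ i, intForm (M i) x = 0) → x = 0 := by
    intro x hx
    funext j
    have h := hx (Sum.inr j)
    have h1 : (sgn (c j) : ℚ) ≠ 0 := by
      have : sgn (c j) ≠ 0 := fun h => by simpa [h] using sgn_abs (c j)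
      exact_mod_cast this
    rw [intForm_apply, Finset.sum_eq_single j] at h
    · simpa [M, h1] using h
    · intro k _ hk
      simp [M, hk]
    · simp
  rcases dotProduct_le_or_exists_sub_mem_cone hβ hMβ hφ (e := e)
    (fun j => (sgn_abs _).le) hc with h | ⟨v, hv0, hvle, hv, hcv⟩
  · rw [hlen c hc] at h
    exact short c ((Nat.cast_le.1 h).trans hN)
  · have hadd : e ⬝ᵥ v + e ⬝ᵥ (c - v) = e ⬝ᵥ c := by rw [dotProduct_sub]; ring
    have hpos : 0 < ∑ j, (v j).natAbs := by
      rw [pos_iff_ne_zero]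
      intro h
      refine hv0 (funext fun j => ?_)
      simpa using Finset.sum_eq_zero_iff.1 h j (Finset.mem_univ j)
    have h2 := hlen v hv
    have hκ : 1 ≤ Fintype.card κ := by
      by_contra! h
      have := Fintype.card_eq_zero_iff.1 (by omega : Fintype.card κ = 0)
      exact hv0 (Subsingleton.elim _ _)
    rw [hlen v hv, hlen _ hcv, hlen c hc, ← Nat.cast_add, Nat.cast_inj] at hadd
    have hPv : P v := by
      refine short v (le_trans ?_ ((Nat.le_mul_of_pos_left _ hκ).trans hN))
      rw [hlen v hv] at hvle
      exact_mod_cast hvle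
    have := add v (c - v) (fun i => ?_) hPv (ih _ (by omega) (c - v) rfl)
    · rwa [add_sub_cancel] at this
    · refine sgn_cases (A.mulVec c i) _ _ ?_ ?_
      · rw [← hMl]
        exact hv _
      · rw [← hMl]
        exact hcv _

end Conformal

/-! ### Binomials and the lattice of the saturation. -/

namespace BinomialNorm

open MvPolynomial

variable {r : ℕ}

/-- The exponent vector of a monomial, as an integer vector. -/
def intExponent (s : Fin r →₀ ℕ) : Fin r → ℤ := fun i => s i

/-- The exponent vector with entries `max (u i) 0`. -/
noncomputable def posExponent (u : Fin r → ℤ) : Fin r →₀ ℕ :=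
  Finsupp.equivFunOnFinite.symm fun i => (u i).toNat

theorem intExponent_add (s t : Fin r →₀ ℕ) :
    intExponent (s + t) = intExponent s + intExponent t := by
  ext; simp [intExponent]

theorem intExponent_injective : Function.Injective (intExponent (r := r)) := fun _ _ h =>
  Finsupp.ext fun i => Nat.cast_injective (R := ℤ) (congrFun h i)

theorem intExponent_posExponent {u : Fin r → ℤ} (hu : 0 ≤ u) : intExponent (posExponent u) = u :=
  funext fun i => Int.toNat_of_nonneg (hu i)

theorem intExponent_posExponent_sub (u : Fin r → ℤ) :
    intExponent (posExponent u) - intExponent (posExponent (-u)) = u := by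
  ext i
  simp only [intExponent, posExponent, Finsupp.equivFunOnFinite_symm_apply_apply, Pi.sub_apply,
    Pi.neg_apply]
  omega

theorem posMonomial_eq (u : Fin r → ℤ) : posMonomial u = monomial (posExponent u) 1 := by
  rw [monomial_eq, Finsupp.prod_fintype _ _ (fun _ => pow_zero _), C_1, one_mul]
  rfl

theorem vecBinomial_eq (u : Fin r → ℤ) :
    vecBinomial u = monomial (posExponent u) 1 - monomial (posExponent (-u)) 1 := by
  rw [← posMonomial_eq, ← posMonomial_eq]
  rfl

theorem monomial_mul_vecBinomial (q : Fin r →₀ ℕ) (u : Fin r → ℤ) :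
    monomial q 1 * vecBinomial u =
      monomial (q + posExponent u) 1 - monomial (q + posExponent (-u)) 1 := by
  rw [vecBinomial_eq, mul_sub, monomial_mul, monomial_mul, one_mul]

/-- A difference of two monomials is a multiple of the binomial of its exponent difference. -/
theorem exists_monomial_sub_eq {s t : Fin r →₀ ℕ} {u : Fin r → ℤ}
    (h : intExponent s - intExponent t = u) :
    ∃ q : Fin r →₀ ℕ, (monomial s 1 - monomial t 1 : MvPolynomial (Fin r) ℤ) =
      monomial q 1 * vecBinomial u := by
  refine ⟨s ⊓ t, ?_⟩
  have hu : ∀ i, (s i : ℤ) - t i = u i := congrFun h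
  rw [monomial_mul_vecBinomial]
  congr 2 <;>
  · congr 1
    ext i
    have := hu i
    simp [posExponent]
    omega

theorem prod_X_pow_eq (m : ℕ) :
    (∏ i, X i : MvPolynomial (Fin r) ℤ) ^ m = monomial (Finsupp.equivFunOnFinite.symm fun _ => m) 1 := by
  rw [monomial_eq, Finsupp.prod_fintype _ _ (fun _ => pow_zero _), C_1, one_mul,
    ← Finset.prod_pow]
  rfl

/-- Every monomial divides a power of the product of the variables. -/
theorem mem_saturation_of_monomial_mul_mem {I : Ideal (MvPolynomial (Fin r) ℤ)}
    {q : Fin r →₀ ℕ} {g : MvPolynomial (Fin r) ℤ}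
    (h : monomial q 1 * g ∈ saturation I (∏ i, X i)) : g ∈ saturation I (∏ i, X i) := by
  obtain ⟨m, hm, hg⟩ := h
  refine ⟨m + q.degree, by omega, ?_⟩
  have : (∏ i, X i : MvPolynomial (Fin r) ℤ) ^ q.degree =
      monomial ((Finsupp.equivFunOnFinite.symm fun _ => q.degree) - q) 1 * monomial q 1 := by
    rw [prod_X_pow_eq, monomial_mul, one_mul, tsub_add_cancel_of_le]
    exact fun i => Finsupp.le_degree i q
  rw [pow_add, this]
  convert I.mul_mem_left (monomial ((Finsupp.equivFunOnFinite.symm fun _ => q.degree) - q) 1) hg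
    using 1
  ring

theorem vecBinomial_mem_saturation (B : Finset (Fin r → ℤ)) {b : Fin r → ℤ} (hb : b ∈ B) :
    vecBinomial b ∈ saturation (vecIdeal B) (∏ i, X i) :=
  ⟨1, one_pos, Ideal.mul_mem_right _ _ (Ideal.subset_span ⟨b, hb, rfl⟩)⟩

/-- The integer vectors `u` such that all differences of monomials whose exponents differ by `u`
lie in the saturation of `I`. -/
def saturationLattice (I : Ideal (MvPolynomial (Fin r) ℤ)) : AddSubgroup (Fin r → ℤ) where
  carrier := {u | ∀ s t, intExponent s - intExponent t = u →
    monomial s 1 - monomial t 1 ∈ saturation I (∏ i, X i)}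
  zero_mem' := by
    intro s t h
    rw [intExponent_injective (sub_eq_zero.1 h), sub_self]
    exact zero_mem _
  add_mem' := by
    intro u v hu hv s t h
    -- The exponent `t + v` may be negative somewhere; multiplying by x^{v⁻} makes the intermediate
    -- exponent `t + v⁺`.
    apply mem_saturation_of_monomial_mul_mem (q := posExponent (-v))
    rw [mul_sub, monomial_mul, monomial_mul, one_mul]
    have key := intExponent_posExponent_sub v
    have h1 := hu (posExponent (-v) + s) (t + posExponent v) (by
      rw [intExponent_add, intExponent_add]
      linear_combination h - key)
    have h2 := hv (t + posExponent v) (posExponent (-v) + t) (by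
      rw [intExponent_add, intExponent_add]
      linear_combination key)
    simpa using add_mem h1 h2
  neg_mem' := by
    intro u hu s t h
    rw [← neg_sub]
    exact neg_mem (hu t s (by rw [← neg_sub, h, neg_neg]))

theorem mem_saturationLattice (B : Finset (Fin r → ℤ)) {b : Fin r → ℤ} (hb : b ∈ B) :
    b ∈ saturationLattice (vecIdeal B) := by
  intro s t h
  obtain ⟨q, hq⟩ := exists_monomial_sub_eq h
  rw [hq]
  exact Ideal.mul_mem_left _ _ (vecBinomial_mem_saturation B hb)

/-- The matrix whose columns are the elements of `B`. -/
def columnMatrix (B : Finset (Fin r → ℤ)) : Matrix (Fin r) B ℤ := fun i b => b.1 i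

theorem columnMatrix_mulVec (B : Finset (Fin r → ℤ)) (c : B → ℤ) :
    (columnMatrix B).mulVec c = ∑ b, c b • b.1 := by
  ext i
  simp [columnMatrix, Matrix.mulVec, dotProduct, mul_comm]

theorem columnMatrix_mulVec_mem (B : Finset (Fin r → ℤ)) (c : B → ℤ) :
    (columnMatrix B).mulVec c ∈ saturationLattice (vecIdeal B) := by
  rw [columnMatrix_mulVec]
  exact sum_mem fun b _ => zsmul_mem (mem_saturationLattice B b.2) _

/-! ### The saturation as a lattice ideal. -/

/-- The map from the polynomial ring to the group ring of the quotient of `ℤ^r` by a lattice. -/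
noncomputable def latticeMap (L : Submodule ℤ (Fin r → ℤ)) :
    MvPolynomial (Fin r) ℤ →ₐ[ℤ] AddMonoidAlgebra ℤ ((Fin r → ℤ) ⧸ L) :=
  aeval fun i => AddMonoidAlgebra.single (L.mkQ (Pi.single i 1)) 1

theorem aeval_single_monomial {H : Type*} [AddCommGroup H] (f : (Fin r → ℤ) →+ H)
    (s : Fin r →₀ ℕ) :
    aeval (fun i => (AddMonoidAlgebra.single (f (Pi.single i 1)) 1 : AddMonoidAlgebra ℤ H))
      (monomial s (1 : ℤ)) = AddMonoidAlgebra.single (f (intExponent s)) 1 := by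
  have h : intExponent s = ∑ i, s i • Pi.single i (1 : ℤ) := by
    ext j
    simp [intExponent, Finset.sum_apply, Pi.single_apply]
  rw [aeval_monomial, map_one, one_mul, Finsupp.prod_fintype _ _ (fun _ => pow_zero _), h, map_sum]
  simp_rw [AddMonoidAlgebra.single_pow, one_pow, map_nsmul]
  induction (Finset.univ : Finset (Fin r)) using Finset.induction_on with
  | empty => simp [AddMonoidAlgebra.one_def]
  | insert a S ha ih => rw [Finset.prod_insert ha, Finset.sum_insert ha, ih,
      AddMonoidAlgebra.single_mul_single, one_mul]

theorem latticeMap_monomial (L : Submodule ℤ (Fin r → ℤ)) (s : Fin r →₀ ℕ) :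
    latticeMap L (monomial s 1) = AddMonoidAlgebra.single (L.mkQ (intExponent s)) 1 :=
  aeval_single_monomial L.mkQ.toAddMonoidHom s

theorem toLaurent_monomial (s : Fin r →₀ ℕ) :
    toLaurent r (monomial s 1) = laurentMonomial (intExponent s) :=
  aeval_single_monomial (AddMonoidHom.id _) s

/-- An ideal containing all differences of monomials that are congruent modulo `L` contains the
kernel of the map to the group ring of `ℤ^r / L`. -/
theorem mem_of_latticeMap_eq_zero {L : Submodule ℤ (Fin r → ℤ)}
    {J : Ideal (MvPolynomial (Fin r) ℤ)}
    (hJ : ∀ s t, intExponent s - intExponent t ∈ L → monomial s 1 - monomial t 1 ∈ J)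
    {a : MvPolynomial (Fin r) ℤ} (ha : latticeMap L a = 0) : a ∈ J := by
  classical
  let rep : (Fin r → ℤ) ⧸ L → MvPolynomial (Fin r) ℤ ⧸ J := fun x =>
    if h : ∃ s, L.mkQ (intExponent s) = x then Ideal.Quotient.mk J (monomial h.choose 1) else 0
  have hrep : ∀ s, rep (L.mkQ (intExponent s)) = Ideal.Quotient.mk J (monomial s 1) := by
    intro s
    have h : ∃ t, L.mkQ (intExponent t) = L.mkQ (intExponent s) := ⟨s, rfl⟩
    dsimp only [rep]
    rw [dif_pos h, Ideal.Quotient.eq]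
    exact hJ _ _ ((Submodule.Quotient.eq L).1 h.choose_spec)
  -- Only an additive map is needed: composed with `latticeMap L` it is reduction modulo `J`.
  let ψ : AddMonoidAlgebra ℤ ((Fin r → ℤ) ⧸ L) →+ MvPolynomial (Fin r) ℤ ⧸ J :=
    (Finsupp.linearCombination ℤ rep).toAddMonoidHom.comp
      AddMonoidAlgebra.coeffAddEquiv.toAddMonoidHom
  have hψ : ∀ p, ψ (latticeMap L p) = Ideal.Quotient.mk J p := by
    intro p
    induction p using MvPolynomial.induction_on' with
    | monomial s n =>
      have : (monomial s n : MvPolynomial (Fin r) ℤ) = n • monomial s 1 := by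
        rw [smul_monomial, smul_eq_mul, mul_one]
      rw [this, map_zsmul, map_zsmul, map_zsmul, latticeMap_monomial, ← hrep]
      congr 1
      change Finsupp.linearCombination ℤ rep (Finsupp.single _ 1) = _
      rw [Finsupp.linearCombination_single, one_smul]
    | add p q hp hq => rw [map_add, map_add, map_add, hp, hq]
  rw [← Ideal.Quotient.eq_zero_iff_mem, ← hψ, ha, map_zero]

/-- In the group ring of the quotient by the span of `B`, the generators of `vecIdeal B` vanish and
monomials become units, so the whole saturation maps to zero. -/
theorem saturation_le_of_monomial_sub_mem {B : Finset (Fin r → ℤ)}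
    {J : Ideal (MvPolynomial (Fin r) ℤ)}
    (hJ : ∀ (c : B → ℤ) s t, intExponent s - intExponent t = (columnMatrix B).mulVec c →
      monomial s 1 - monomial t 1 ∈ J) :
    saturation (vecIdeal B) (∏ i, X i) ≤ J := by
  classical
  rintro a ⟨m, -, ha⟩
  set L := LinearMap.range (columnMatrix B).mulVecLin with hL
  refine mem_of_latticeMap_eq_zero (L := L) ?_ ?_
  · rintro s t ⟨c, hc⟩
    exact hJ c s t hc.symm
  · have hker : vecIdeal B ≤ RingHom.ker (latticeMap L) := by
      refine Ideal.span_le.2 ?_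
      rintro _ ⟨b, hb, rfl⟩
      rw [SetLike.mem_coe, RingHom.mem_ker, vecBinomial_eq, map_sub, latticeMap_monomial,
        latticeMap_monomial, sub_eq_zero]
      congr 1
      refine (Submodule.Quotient.eq L).2 ?_
      rw [intExponent_posExponent_sub]
      refine ⟨Pi.single ⟨b, hb⟩ 1, ?_⟩
      rw [Matrix.mulVecLin_apply, Matrix.mulVec_single_one]
      rfl
    have h0 : latticeMap L a * latticeMap L ((∏ i, X i) ^ m) = 0 := by
      rw [← map_mul]
      exact hker ha
    rw [prod_X_pow_eq, latticeMap_monomial] at h0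
    set x := L.mkQ (intExponent (Finsupp.equivFunOnFinite.symm fun _ : Fin r => m))
    calc latticeMap L a = latticeMap L a * AddMonoidAlgebra.single x 1 *
          AddMonoidAlgebra.single (-x) 1 := by
          rw [mul_assoc, AddMonoidAlgebra.single_mul_single, add_neg_cancel, one_mul,
            ← AddMonoidAlgebra.one_def, mul_one]
      _ = 0 := by rw [h0, zero_mul]

/-- The binomials of the integer combinations of `B` with coefficients of total size at most `N`. -/
noncomputable def shortBinomials (B : Finset (Fin r → ℤ)) (N : ℕ) :
    Set (MvPolynomial (Fin r) ℤ) :=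
  (fun c : B → ℤ => vecBinomial ((columnMatrix B).mulVec c)) '' {c | ∑ b, (c b).natAbs ≤ N}

theorem shortBinomials_finite (B : Finset (Fin r → ℤ)) (N : ℕ) : (shortBinomials B N).Finite := by
  refine Set.Finite.image _ ((Set.finite_Icc (fun _ : B => -(N : ℤ)) fun _ => N).subset ?_)
  intro c hc
  have h : ∀ b, (c b).natAbs ≤ N := fun b =>
    (Finset.single_le_sum (fun _ _ => Nat.zero_le _) (Finset.mem_univ b)).trans hc
  exact ⟨fun b => by have := h b; dsimp only; omega, fun b => by have := h b; dsimp only; omega⟩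

theorem natAbs_le_maxEntry {B : Finset (Fin r → ℤ)} {b : Fin r → ℤ} (hb : b ∈ B) (i : Fin r) :
    (b i).natAbs ≤ maxEntry B :=
  (Finset.le_sup (f := fun i => (b i).natAbs) (Finset.mem_univ i)).trans
    (Finset.le_sup (f := fun b : Fin r → ℤ => Finset.univ.sup fun i => (b i).natAbs) hb)

theorem span_shortBinomials (B : Finset (Fin r → ℤ)) {N : ℕ}
    (hN : B.card * (B.card * (B.card * max 1 (maxEntry B)) ^ (B.card - 1)) ≤ N) :
    Ideal.span (shortBinomials B N) = saturation (vecIdeal B) (∏ i, X i) := by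
  apply le_antisymm
  · refine Ideal.span_le.2 ?_
    rintro _ ⟨c, -, rfl⟩
    simp only [SetLike.mem_coe, vecBinomial_eq]
    exact columnMatrix_mulVec_mem B c _ _ (intExponent_posExponent_sub _)
  · refine saturation_le_of_monomial_sub_mem fun c => ?_
    refine conformal_induction (A := columnMatrix B) (β := max 1 (maxEntry B)) (le_max_left _ _)
      (fun i b => ?_) (N := N) (by simpa only [Fintype.card_coe] using hN)
      (P := fun c => ∀ s t, intExponent s - intExponent t = (columnMatrix B).mulVec c →
        monomial s 1 - monomial t 1 ∈ Ideal.span (shortBinomials B N)) ?_ ?_ c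
    · rw [Int.abs_eq_natAbs]
      exact_mod_cast (natAbs_le_maxEntry b.2 i).trans (le_max_right _ _)
    · intro c hc s t h
      obtain ⟨q, hq⟩ := exists_monomial_sub_eq h
      rw [hq]
      exact Ideal.mul_mem_left _ _ (Ideal.subset_span ⟨c, hc, rfl⟩)
    · intro v w hvw hv hw s t h
      rw [Matrix.mulVec_add] at h
      have hp : intExponent (posExponent (intExponent t + (columnMatrix B).mulVec v)) =
          intExponent t + (columnMatrix B).mulVec v := by
        -- Where `A v ≥ 0` the exponent is at least that of `t`; elsewhere `A w ≤ 0`, and `t + A v =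
        -- s - A w` is at least `s`.
        refine intExponent_posExponent fun i => ?_
        have h1 := congrFun h i
        have h2 := hvw i
        simp only [intExponent, Pi.sub_apply, Pi.add_apply, Pi.zero_apply] at h1 ⊢
        omega
      have h1 := hw s (posExponent (intExponent t + (columnMatrix B).mulVec v))
        (by rw [hp, ← sub_sub, h, add_sub_cancel_left])
      have h2 := hv (posExponent (intExponent t + (columnMatrix B).mulVec v)) t
        (by rw [hp, add_sub_cancel_left])
      simpa using add_mem h1 h2

/-! ### Signed sums of Laurent multiples, and the bound. -/

/-- `f` is a sum of `N` signed Laurent monomial multiples of binomials of elements of `B`. -/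
def IsLaurentSignedSum (B : Finset (Fin r → ℤ)) (N : ℕ) (f : LaurentRing r) : Prop :=
  ∃ (ε : Fin N → ℤ) (d : Fin N → Fin r → ℤ) (b : Fin N → Fin r → ℤ),
    (∀ i, ε i = -1 ∨ ε i = 0 ∨ ε i = 1) ∧ (∀ i, b i ∈ B) ∧
    f = ∑ i, ε i • (laurentMonomial (d i) * toLaurent r (vecBinomial (b i)))

theorem IsLaurentSignedSum.cons {B : Finset (Fin r → ℤ)} {N : ℕ} {f : LaurentRing r}
    (hf : IsLaurentSignedSum B N f) {ε : ℤ} (hε : ε = -1 ∨ ε = 0 ∨ ε = 1) (d : Fin r → ℤ)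
    {b : Fin r → ℤ} (hb : b ∈ B) :
    IsLaurentSignedSum B (N + 1)
      (ε • (laurentMonomial d * toLaurent r (vecBinomial b)) + f) := by
  obtain ⟨ε', d', b', h1, h2, rfl⟩ := hf
  refine ⟨Fin.cons ε ε', Fin.cons d d', Fin.cons b b', Fin.cases hε h1, Fin.cases hb h2, ?_⟩
  rw [Fin.sum_univ_succ]
  simp

theorem laurentMonomial_mul (d e : Fin r → ℤ) :
    laurentMonomial d * laurentMonomial e = laurentMonomial (d + e) := by
  rw [laurentMonomial, laurentMonomial, AddMonoidAlgebra.single_mul_single, one_mul]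
  rfl

theorem laurentMonomial_add_sub (d b : Fin r → ℤ) :
    laurentMonomial (d + b) - laurentMonomial d =
      laurentMonomial (d - intExponent (posExponent (-b))) * toLaurent r (vecBinomial b) := by
  rw [vecBinomial_eq, map_sub, toLaurent_monomial, toLaurent_monomial, mul_sub,
    laurentMonomial_mul, laurentMonomial_mul, sub_add_cancel, sub_add_eq_add_sub, add_sub_assoc,
    intExponent_posExponent_sub]

/-- Telescoping along a lattice path of length at most `N`. -/
theorem isLaurentSignedSum_of_sum_natAbs_le {B : Finset (Fin r → ℤ)} (hB : B.Nonempty) {N : ℕ}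
    (c : B → ℤ) (hc : ∑ b, (c b).natAbs ≤ N) (d : Fin r → ℤ) :
    IsLaurentSignedSum B N
      (laurentMonomial (d + (columnMatrix B).mulVec c) - laurentMonomial d) := by
  classical
  induction N generalizing c d with
  | zero =>
    have : c = 0 := funext fun b => by
      simpa using Finset.sum_eq_zero_iff.1 (Nat.le_zero.1 hc) b (Finset.mem_univ b)
    rw [this, Matrix.mulVec_zero, add_zero, sub_self]
    exact ⟨0, 0, fun i => i.elim0, fun i => i.elim0, fun i => i.elim0, by simp⟩
  | succ N ih =>
    by_cases h0 : c = 0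
    -- A zero coefficient pads the sum to exactly `N + 1` terms.
    · obtain ⟨b, hb⟩ := hB
      have := (ih 0 (by simp) d).cons (ε := 0) (by simp) 0 hb
      rw [h0]
      simpa using this
    · obtain ⟨b, hb⟩ := Function.ne_iff.1 h0
      have hb : c b ≠ 0 := hb
      have key : ∀ ε : ℤ, (c b - ε).natAbs + 1 = (c b).natAbs →
          ∑ j, ((c - Pi.single b ε : B → ℤ) j).natAbs ≤ N := by
        intro ε hε
        have h1 := Finset.add_sum_erase Finset.univ (fun j => (c j).natAbs) (Finset.mem_univ b)
        have h2 := Finset.add_sum_erase Finset.univ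
          (fun j => ((c - Pi.single b ε : B → ℤ) j).natAbs) (Finset.mem_univ b)
        have h3 : ∑ j ∈ Finset.univ.erase b, ((c - Pi.single b ε : B → ℤ) j).natAbs =
            ∑ j ∈ Finset.univ.erase b, (c j).natAbs :=
          Finset.sum_congr rfl fun j hj => by simp [Finset.ne_of_mem_erase hj]
        simp only [Pi.sub_apply, Pi.single_eq_same] at h2 h3 ⊢
        omega
      have hcol : ∀ ε : ℤ, (columnMatrix B).mulVec (Pi.single b ε) = ε • b.1 := by
        intro ε
        rw [columnMatrix_mulVec, Finset.sum_eq_single b] <;> simp +contextual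
      rcases lt_or_gt_of_ne hb with h | h
      · have h1 := (ih (c - Pi.single b (-1)) (key (-1) (by omega)) (d - b.1)).cons
          (ε := -1) (by simp) (d - b.1 - intExponent (posExponent (-b.1))) b.2
        rw [← laurentMonomial_add_sub, Matrix.mulVec_sub, hcol] at h1
        convert h1 using 1
        simp only [sub_add_cancel, neg_smul, one_smul, sub_neg_eq_add]
        rw [show d - b.1 + ((columnMatrix B).mulVec c + b.1) = d + (columnMatrix B).mulVec c by abel]
        abel
      · have h1 := (ih (c - Pi.single b 1) (key 1 (by omega)) (d + b.1)).cons
          (ε := 1) (by simp) (d - intExponent (posExponent (-b.1))) b.2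
        rw [← laurentMonomial_add_sub, Matrix.mulVec_sub, hcol] at h1
        convert h1 using 1
        simp only [one_smul]
        rw [show d + b.1 + ((columnMatrix B).mulVec c - b.1) = d + (columnMatrix B).mulVec c by abel]
        abel

theorem isSignedSum_of_mem_shortBinomials {B : Finset (Fin r → ℤ)} (hB : B.Nonempty) {N : ℕ}
    {g : MvPolynomial (Fin r) ℤ} (hg : g ∈ shortBinomials B N) : IsSignedSum B N g := by
  obtain ⟨c, hc, rfl⟩ := hg
  have h := isLaurentSignedSum_of_sum_natAbs_le hB c hc
    (intExponent (posExponent (-(columnMatrix B).mulVec c)))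
  rw [← sub_eq_iff_eq_add'.1 (intExponent_posExponent_sub _), ← toLaurent_monomial,
    ← toLaurent_monomial, ← map_sub, ← vecBinomial_eq] at h
  exact h

theorem mem_normSet {B : Finset (Fin r → ℤ)} (hB : B.Nonempty) {N : ℕ} (hN1 : 1 ≤ N)
    (hN : B.card * (B.card * (B.card * max 1 (maxEntry B)) ^ (B.card - 1)) ≤ N) :
    N ∈ normSet B := by
  refine ⟨hN1, (shortBinomials_finite B N).toFinset, ?_, ?_, ?_⟩
  · rw [Set.Finite.coe_toFinset, span_shortBinomials B hN]
  · intro g hg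
    obtain ⟨c, -, rfl⟩ := (Set.Finite.mem_toFinset _).1 hg
    exact ⟨_, _, vecBinomial_eq _⟩
  · exact fun g hg => isSignedSum_of_mem_shortBinomials hB ((Set.Finite.mem_toFinset _).1 hg)

/-- Two distinct vectors cannot both be zero. -/
theorem one_le_maxEntry {B : Finset (Fin r → ℤ)} (hB : 1 < B.card) : 1 ≤ maxEntry B := by
  by_contra! h
  obtain ⟨a, ha, b, hb, hab⟩ := Finset.one_lt_card.1 hB
  refine hab (funext fun i => ?_)
  have h1 := natAbs_le_maxEntry ha i
  have h2 := natAbs_le_maxEntry hb i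
  omega

end BinomialNorm

/-- The norm of `B` exists (the defining set has a least element, namely `norm B`), and it is at
most `n (2 n β)^(n-1)`, where `n` is the number of vectors in `B`. -/
theorem theorem1p2 (r : ℕ) (B : Finset (Fin r → ℤ)) (hB : 1 ≤ B.card) :
    IsLeast (BinomialNorm.normSet B) (BinomialNorm.norm B) ∧
      BinomialNorm.norm B ≤
        B.card * (2 * B.card * BinomialNorm.maxEntry B) ^ (B.card - 1) := by
  have hmem : B.card * (2 * B.card * BinomialNorm.maxEntry B) ^ (B.card - 1) ∈
      BinomialNorm.normSet B := by
    rcases hB.eq_or_lt with h | h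
    -- For n = 1 the exponent is 0 and the bound is 1, even if β = 0.
    · apply BinomialNorm.mem_normSet (Finset.card_pos.1 hB) <;> simp [← h]
    · have hβ := BinomialNorm.one_le_maxEntry h
      apply BinomialNorm.mem_normSet (Finset.card_pos.1 hB)
      · exact Nat.mul_pos hB (Nat.pow_pos (by positivity))
      · rw [max_eq_right hβ, mul_assoc 2, mul_pow 2]
        have h2 : B.card ≤ 2 ^ (B.card - 1) := by
          have := Nat.lt_two_pow_self (n := B.card - 1)
          omega
        gcongr
  exact ⟨⟨Nat.sInf_mem ⟨_, hmem⟩, fun _ h => Nat.sInf_le h⟩, Nat.sInf_le hmem⟩
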